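/- Let $\alpha>0$ and let $d\lambda_\alpha(w)=\frac{\alpha}{\pi}e^{-\alpha|w|^2}\,dA(w)$ be the Gaussian measure on $\mathbb{C}$, where $dA$ is Lebesgue area measure. Let $F_\alpha^2$ be the Fock space of entire functions in $L^2(\mathbb{C},d\lambda_\alpha)$, with inner product $\langle f,g\rangle=\int_{\mathbb{C}} f\overline{g}\,d\lambda_\alpha$ and orthonormal basis $e_n(w)=\sqrt{\alpha^n/n!}\,w^n$ ($n\ge 0$), and let $P:L^2(\mathbb{C},d\lambda_\alpha)\to F_\alpha^2$ be the orthogonal projection. Let $K:F_\alpha^2\to L^2(\mathbb{C},d\lambda_\alpha)$ be the bounded linear operator with $K e_{2n}=e_n$ and $K e_{2n+1}=\overline{e_{n+1}}$ for all $n\ge 0$. For $z\in\mathbb{C}$ let $K_z(w)=e^{\alpha\overline{z}w}$ be the reproducing kernel of $F_\alpha^2$, let $k_z=K_z/\|K_z\|$, and put $I(z,w)=K(k_z)(w)$. For $\phi\in L^\infty(\mathbb{C})$ let $S_\phi:F_\alpha^2\to F_\alpha^2$, $S_\phi f=P(\phi\,K f)$, be the H-Toeplitz operator with symbol $\phi$,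 and let $\widetilde{S_\phi}(z)=\langle S_\phi k_z,k_z\rangle$ be its Berezin transform. Then for every $\phi\in L^\infty(\mathbb{C})$ and every $z\in\mathbb{C}$, the function $w\mapsto\phi(w)I(z,w)e^{\alpha z\overline{w}}$ is $\lambda_\alpha$-integrable and $$\widetilde{S_\phi}(z)=e^{-\frac{\alpha|z|^2}{2}}\int_{\mathbb{C}}\phi(w)\,I(z,w)\,e^{\alpha z\overline{w}}\,d\lambda_\alpha(w).$$ Moreover, $\widetilde{S_\phi}(z)\to 0$ as $|z|\to\infty$. -/

import Mathlib

open MeasureTheory Filter Topology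
open scoped ENNReal ComplexConjugate

noncomputable section

namespace HToeplitz

/-- The density of the Gaussian measure with respect to the Lebesgue area measure. -/
def gaussianDensity (α : ℝ) (z : ℂ) : ℝ := α / Real.pi * Real.exp (-α * ‖z‖ ^ 2)

/-- The Gaussian measure `dλ_α(z) = (α / π) e^{-α |z|²} dA(z)` on `ℂ`. -/
def gaussianMeasure (α : ℝ) : Measure ℂ :=
  volume.withDensity fun z => ENNReal.ofReal (gaussianDensity α z)

theorem continuous_gaussianDensity (α : ℝ) : Continuous (gaussianDensity α) := by
  unfold gaussianDensity; fun_prop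

theorem gaussianDensity_pos {α : ℝ} (hα : 0 < α) (z : ℂ) : 0 < gaussianDensity α z := by
  unfold gaussianDensity; positivity

theorem gaussianMeasure_ac (α : ℝ) : gaussianMeasure α ≪ volume :=
  withDensity_absolutelyContinuous _ _

theorem ac_gaussianMeasure {α : ℝ} (hα : 0 < α) : volume ≪ gaussianMeasure α :=
  withDensity_absolutelyContinuous'
    (continuous_gaussianDensity α).measurable.ennreal_ofReal.aemeasurable
    (ae_of_all _ fun z => (ENNReal.ofReal_pos.2 (gaussianDensity_pos hα z)).ne')

theorem integral_gaussianMeasure {α : ℝ} (hα : 0 < α) (f : ℂ → ℂ) :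
    ∫ z, f z ∂gaussianMeasure α = ∫ z, gaussianDensity α z • f z := by
  unfold gaussianMeasure
  rw [integral_withDensity_eq_integral_toReal_smul
    (continuous_gaussianDensity α).measurable.ennreal_ofReal (by simp)]
  simp [ENNReal.toReal_ofReal (gaussianDensity_pos hα _).le]

theorem integrable_gaussianMeasure_iff {α : ℝ} (hα : 0 < α) {E : Type*} [NormedAddCommGroup E]
    [NormedSpace ℝ E] (f : ℂ → E) :
    Integrable f (gaussianMeasure α) ↔ Integrable fun z => gaussianDensity α z • f z := by
  unfold gaussianMeasure
  rw [integrable_withDensity_iff_integrable_smul'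
    (continuous_gaussianDensity α).measurable.ennreal_ofReal (by simp)]
  simp [ENNReal.toReal_ofReal (gaussianDensity_pos hα _).le]

theorem memLp_of_le_exp {α : ℝ} (hα : 0 < α) {f : ℂ → ℂ} (hf : Continuous f) {C c : ℝ}
    (h : ∀ z, ‖f z‖ ≤ C * Real.exp (c * ‖z‖)) : MemLp f 2 (gaussianMeasure α) := by
  rw [memLp_two_iff_integrable_sq_norm hf.aestronglyMeasurable,
    integrable_gaussianMeasure_iff hα]
  have h0 : Integrable fun z : ℂ =>
      α / Real.pi * C ^ 2 * Real.exp (2 * c ^ 2 / α) * Real.exp (-(α / 2) * ‖z‖ ^ 2) := by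
    have := (GaussianFourier.integrable_cexp_neg_mul_sq_norm_add (b := ((α / 2 : ℝ) : ℂ))
      (V := ℂ) (by simpa using hα) 0 0).norm
    refine (this.congr (ae_of_all _ fun z => ?_)).const_mul _
    simp only [zero_mul, add_zero, Complex.norm_exp]
    congr 1
    norm_cast
  refine h0.mono' (((continuous_gaussianDensity α).smul (hf.norm.pow 2)).aestronglyMeasurable)
    (ae_of_all _ fun z => ?_)
  rw [smul_eq_mul, Real.norm_of_nonneg (mul_nonneg (gaussianDensity_pos hα z).le (sq_nonneg _))]
  have h1 : ‖f z‖ ^ 2 ≤ (C * Real.exp (c * ‖z‖)) ^ 2 :=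
    pow_le_pow_left₀ (norm_nonneg _) (h z) 2
  have h2 : Real.exp (-α * ‖z‖ ^ 2) * Real.exp (c * ‖z‖) ^ 2
      ≤ Real.exp (2 * c ^ 2 / α) * Real.exp (-(α / 2) * ‖z‖ ^ 2) := by
    rw [← Real.exp_nat_mul, ← Real.exp_add, ← Real.exp_add]
    apply Real.exp_le_exp.2
    have : 2 * c ^ 2 / α + -(α / 2) * ‖z‖ ^ 2 - (-α * ‖z‖ ^ 2 + (2 : ℕ) * (c * ‖z‖))
        = (2 * c - α * ‖z‖) ^ 2 / (2 * α) := by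
      field_simp; push_cast; ring
    have h3 : 0 ≤ (2 * c - α * ‖z‖) ^ 2 / (2 * α) := by positivity
    linarith
  calc gaussianDensity α z * ‖f z‖ ^ 2
      ≤ gaussianDensity α z * (C * Real.exp (c * ‖z‖)) ^ 2 :=
        mul_le_mul_of_nonneg_left h1 (gaussianDensity_pos hα z).le
    _ = α / Real.pi * C ^ 2 * (Real.exp (-α * ‖z‖ ^ 2) * Real.exp (c * ‖z‖) ^ 2) := by
        unfold gaussianDensity; ring
    _ ≤ α / Real.pi * C ^ 2 * (Real.exp (2 * c ^ 2 / α) * Real.exp (-(α / 2) * ‖z‖ ^ 2)) :=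
        mul_le_mul_of_nonneg_left h2 (by positivity)
    _ = _ := by ring

/-- The function `e_n(z) = √(α^n / n!) z^n`. -/
def monomialFun (α : ℝ) (n : ℕ) (z : ℂ) : ℂ := (Real.sqrt (α ^ n / n.factorial) : ℂ) * z ^ n

/-- The reproducing kernel `K_z(w) = e^{α \bar z w}`. -/
def kernelFun (α : ℝ) (z w : ℂ) : ℂ := Complex.exp (α * conj z * w)

theorem differentiable_monomialFun (α : ℝ) (n : ℕ) : Differentiable ℂ (monomialFun α n) := by
  unfold monomialFun; fun_prop

theorem differentiable_kernelFun (α : ℝ) (z : ℂ) : Differentiable ℂ (kernelFun α z) := by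
  unfold kernelFun; fun_prop

theorem norm_pow_le_exp (n : ℕ) (z : ℂ) : ‖z‖ ^ n ≤ n.factorial * Real.exp (1 * ‖z‖) := by
  have := Real.pow_div_factorial_le_exp ‖z‖ (norm_nonneg z) n
  rw [one_mul]
  rwa [div_le_iff₀' (by positivity)] at this

theorem memLp_pow {α : ℝ} (hα : 0 < α) (n : ℕ) :
    MemLp (fun z : ℂ => z ^ n) 2 (gaussianMeasure α) :=
  memLp_of_le_exp hα (by fun_prop) (C := n.factorial)
    (fun z => by rw [norm_pow]; exact norm_pow_le_exp n z)

theorem memLp_monomialFun {α : ℝ} (hα : 0 < α) (n : ℕ) :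
    MemLp (monomialFun α n) 2 (gaussianMeasure α) :=
  (memLp_pow hα n).const_mul _

theorem memLp_kernelFun {α : ℝ} (hα : 0 < α) (z : ℂ) :
    MemLp (kernelFun α z) 2 (gaussianMeasure α) := by
  refine memLp_of_le_exp hα (differentiable_kernelFun α z).continuous (C := 1) (c := α * ‖z‖)
    fun w => ?_
  rw [kernelFun, one_mul]
  refine (Complex.norm_exp_le_exp_norm _).trans (le_of_eq ?_)
  simp [abs_of_pos hα]

/-- The Fock space `F_α²`, as a subspace of `L²(ℂ, dλ_α)`: the classes of those entire functions
that are square integrable with respect to `λ_α`. -/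
def fockSpace (α : ℝ) : Submodule ℂ (Lp ℂ 2 (gaussianMeasure α)) where
  carrier := {f | ∃ g : ℂ → ℂ, Differentiable ℂ g ∧ f =ᵐ[gaussianMeasure α] g}
  add_mem' := by
    rintro f₁ f₂ ⟨g₁, hg₁, h₁⟩ ⟨g₂, hg₂, h₂⟩
    refine ⟨g₁ + g₂, hg₁.add hg₂, ?_⟩
    filter_upwards [Lp.coeFn_add f₁ f₂, h₁, h₂] with z hz h₁ h₂
    rw [hz, Pi.add_apply, Pi.add_apply, h₁, h₂]
  zero_mem' := ⟨0, differentiable_const 0, Lp.coeFn_zero _ _ _⟩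
  smul_mem' := by
    rintro c f ⟨g, hg, h⟩
    refine ⟨c • g, hg.const_smul c, ?_⟩
    filter_upwards [Lp.coeFn_smul c f, h] with z hz h
    simp [hz, h]

theorem toLp_mem_fockSpace {α : ℝ} {g : ℂ → ℂ} (hg : Differentiable ℂ g)
    (h : MemLp g 2 (gaussianMeasure α)) : h.toLp g ∈ fockSpace α :=
  ⟨g, hg, h.coeFn_toLp⟩

section Rotation

theorem integral_rotate {α : ℝ} (hα : 0 < α) (u : Circle) (h : ℂ → ℂ) :
    ∫ z, h (u * z) ∂gaussianMeasure α = ∫ z, h z ∂gaussianMeasure α := by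
  rw [integral_gaussianMeasure hα, integral_gaussianMeasure hα]
  have := (rotation u).measurePreserving.integral_comp
    (rotation u).toHomeomorph.measurableEmbedding (fun z => gaussianDensity α z • h z)
  rw [← this]
  simp [gaussianDensity, Circle.norm_coe]

theorem integrable_rotate {α : ℝ} (hα : 0 < α) (u : Circle) {h : ℂ → ℂ}
    (hh : Integrable h (gaussianMeasure α)) :
    Integrable (fun z => h (u * z)) (gaussianMeasure α) := by
  rw [integrable_gaussianMeasure_iff hα] at hh ⊢
  have := (rotation u).measurePreserving.integrable_comp_of_integrable hh
  refine this.congr (ae_of_all _ fun z => ?_)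
  simp [gaussianDensity, Circle.norm_coe]

instance (α : ℝ) : SFinite (gaussianMeasure α) := by unfold gaussianMeasure; infer_instance

theorem integral_circle {g : ℂ → ℂ} (hg : Differentiable ℂ g) (n : ℕ) (z : ℂ) :
    ∫ θ in (0 : ℝ)..2 * Real.pi, conj (Complex.exp (θ * Complex.I) * z) ^ n *
      g (Complex.exp (θ * Complex.I) * z)
      = 2 * Real.pi * (iteratedDeriv n g 0 / n.factorial) * (‖z‖ ^ (2 * n) : ℝ) := by
  have hG : Differentiable ℂ fun ζ => g (z * ζ) := by fun_prop
  have h1 := DiffContOnCl.circleIntegral_one_div_sub_center_pow_smul (R := 1) (c := 0)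
    one_pos n (hG.diffContOnCl)
  rw [iteratedDeriv_comp_const_mul hg.contDiff] at h1
  simp only [circleIntegral, deriv_circleMap, smul_eq_mul, sub_zero, mul_zero] at h1
  have h2 : ∀ θ : ℝ, conj (Complex.exp (θ * Complex.I) * z) ^ n *
      g (Complex.exp (θ * Complex.I) * z) = conj z ^ n * (-Complex.I) *
      (circleMap 0 1 θ * Complex.I * (1 / circleMap 0 1 θ ^ (n + 1) * g (z * circleMap 0 1 θ))) := by
    intro θ
    have h3 : conj (Complex.exp (θ * Complex.I)) * Complex.exp (θ * Complex.I) = 1 := by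
      rw [← Complex.exp_conj, ← Complex.exp_add]; simp
    have h4 := Complex.exp_ne_zero (θ * Complex.I)
    have h5 : conj (Complex.exp (θ * Complex.I)) = 1 / Complex.exp (θ * Complex.I) := by
      field_simp; exact h3
    simp only [circleMap, Complex.ofReal_one, one_mul, zero_add, map_mul, h5]
    rw [mul_comm z (Complex.exp _)]
    generalize Complex.exp (θ * Complex.I) = E at h4
    simp only [mul_pow, one_div, inv_pow, pow_succ]
    field_simp
    linear_combination (conj z ^ n * g (E * z)) * Complex.I_sq
  simp_rw [h2]
  rw [intervalIntegral.integral_const_mul, h1]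
  have h6 : conj z ^ n * z ^ n = ((‖z‖ ^ (2 * n) : ℝ) : ℂ) := by
    rw [← mul_pow, mul_comm, Complex.mul_conj, Complex.normSq_eq_norm_sq, pow_mul]; push_cast; rfl
  rw [← h6]
  linear_combination (-(conj z ^ n * z ^ n * 2 * Real.pi * iteratedDeriv n g 0 / n.factorial))
    * Complex.I_sq

theorem integral_conj_pow_mul {α : ℝ} (hα : 0 < α) {g : ℂ → ℂ} (hg : Differentiable ℂ g) (n : ℕ)
    (hi : Integrable (fun z => conj z ^ n * g z) (gaussianMeasure α)) :
    ∫ z, conj z ^ n * g z ∂gaussianMeasure α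
      = iteratedDeriv n g 0 / n.factorial * (n.factorial / α ^ n : ℝ) := by
  set h : ℂ → ℂ := fun z => conj z ^ n * g z with hh
  have hc : Continuous h := by
    have := hg.continuous
    rw [hh]; fun_prop
  set e : ℝ → Circle := fun θ => Circle.exp θ
  have he : ∀ θ : ℝ, (e θ : ℂ) = Complex.exp (θ * Complex.I) := fun θ => Circle.coe_exp θ
  have hpi : (0 : ℝ) ≤ 2 * Real.pi := by positivity
  have hint : Integrable (Function.uncurry fun (θ : ℝ) (z : ℂ) => h (e θ * z))
      ((volume.restrict (Set.Ioc 0 (2 * Real.pi))).prod (gaussianMeasure α)) := by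
    rw [integrable_prod_iff]
    · refine ⟨ae_of_all _ fun θ => integrable_rotate hα (e θ) hi, ?_⟩
      have : ∀ θ : ℝ, ∫ z, ‖Function.uncurry (fun (θ : ℝ) (z : ℂ) => h (e θ * z)) (θ, z)‖
          ∂gaussianMeasure α = ∫ z, ‖h z‖ ∂gaussianMeasure α := by
        intro θ
        have := integral_rotate hα (e θ) fun z => ((‖h z‖ : ℝ) : ℂ)
        rw [integral_complex_ofReal, integral_complex_ofReal] at this
        exact_mod_cast this
      simp_rw [this]
      exact integrable_const _
    · refine Continuous.aestronglyMeasurable ?_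
      have : Continuous fun p : ℝ × ℂ => h (Complex.exp (p.1 * Complex.I) * p.2) := by fun_prop
      simpa [Function.uncurry, he] using! this
  have h1 := integral_integral_swap hint
  simp_rw [integral_rotate hα] at h1
  simp only [← intervalIntegral.integral_of_le hpi, he, hh, integral_circle hg] at h1
  rw [intervalIntegral.integral_const, integral_const_mul, integral_complex_ofReal] at h1
  have hM : ∫ z : ℂ, ‖z‖ ^ (2 * n) ∂gaussianMeasure α = n.factorial / α ^ n := by
    have h2 := integral_gaussianMeasure hα fun z => ((‖z‖ ^ (2 * n) : ℝ) : ℂ)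
    rw [integral_complex_ofReal] at h2
    have h3 := Complex.integral_rpow_mul_exp_neg_mul_rpow (p := 2) (q := (2 * n : ℕ)) (b := α)
      (by norm_num) (by have : (0 : ℝ) ≤ (2 * n : ℕ) := by positivity
                        linarith) hα
    have h4 : ∫ z : ℂ, gaussianDensity α z • ((‖z‖ ^ (2 * n) : ℝ) : ℂ)
        = ((α / Real.pi * ∫ z : ℂ, ‖z‖ ^ ((2 * n : ℕ) : ℝ) * Real.exp (-α * ‖z‖ ^ (2 : ℝ)) : ℝ) : ℂ)
        := by
      rw [← integral_const_mul, ← integral_complex_ofReal]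
      congr 1
      ext z
      rw [Real.rpow_natCast, show (2 : ℝ) = (2 : ℕ) by norm_num, Real.rpow_natCast]
      simp only [gaussianDensity, Complex.real_smul]
      push_cast
      ring
    rw [h4, h3] at h2
    have h5 : ∫ z : ℂ, ‖z‖ ^ (2 * n) ∂gaussianMeasure α = _ := Complex.ofReal_injective h2
    rw [h5]
    have h6 : (((2 * n : ℕ) : ℝ) + 2) / 2 = n + 1 := by push_cast; ring
    rw [neg_div, h6, Real.Gamma_nat_eq_factorial, Real.rpow_neg hα.le,
      show (n : ℝ) + 1 = ((n + 1 : ℕ) : ℝ) by push_cast; ring, Real.rpow_natCast]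
    have := Real.pi_pos.ne'
    field_simp
    ring
  rw [hM, sub_zero, Complex.real_smul] at h1
  have hp : ((2 * Real.pi : ℝ) : ℂ) ≠ 0 := by
    exact_mod_cast (by positivity : (2 * Real.pi : ℝ) ≠ 0)
  apply mul_left_cancel₀ hp
  rw [h1]
  push_cast
  ring

end Rotation

theorem memLp_conj (α : ℝ) {f : ℂ → ℂ} (hf : MemLp f 2 (gaussianMeasure α)) :
    MemLp (fun z => conj (f z)) 2 (gaussianMeasure α) :=
  hf.star

theorem inner_toLp (α : ℝ) {f g : ℂ → ℂ} (hf : MemLp f 2 (gaussianMeasure α))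
    (hg : MemLp g 2 (gaussianMeasure α)) :
    inner ℂ (hf.toLp f) (hg.toLp g) = ∫ z, conj (f z) * g z ∂gaussianMeasure α := by
  rw [L2.inner_def]
  refine integral_congr_ae ?_
  filter_upwards [hf.coeFn_toLp, hg.coeFn_toLp] with z h1 h2
  rw [h1, h2, RCLike.inner_apply, mul_comm]

theorem integrable_conj_mul (α : ℝ) {f g : ℂ → ℂ} (hf : MemLp f 2 (gaussianMeasure α))
    (hg : MemLp g 2 (gaussianMeasure α)) :
    Integrable (fun z => conj (f z) * g z) (gaussianMeasure α) :=
  (memLp_conj α hf).integrable_mul hg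

section Basis

variable (α : ℝ) [hα : Fact (0 < α)]

/-- The vector `e_n` of the Fock space, `e_n(z) = √(α^n / n!) z^n`. -/
def basisVec (n : ℕ) : fockSpace α :=
  ⟨(memLp_monomialFun hα.out n).toLp _,
    toLp_mem_fockSpace (differentiable_monomialFun α n) (memLp_monomialFun hα.out n)⟩

/-- The vector `\overline{e_n}` of `L²(ℂ, dλ_α)`. -/
def conjBasisVec (n : ℕ) : Lp ℂ 2 (gaussianMeasure α) :=
  (memLp_conj α (memLp_monomialFun hα.out n)).toLp fun z => conj (monomialFun α n z)

/-- The image of the `n`-th basis vector under the dilation operator: `e_m` if `n = 2 m` is even,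
and `\overline{e_{m+1}}` if `n = 2 m + 1` is odd. -/
def dilationVec (n : ℕ) : Lp ℂ 2 (gaussianMeasure α) :=
  if Even n then (basisVec α (n / 2) : Lp ℂ 2 (gaussianMeasure α)) else conjBasisVec α (n / 2 + 1)

theorem integral_conj_pow_mul_pow (m n : ℕ) :
    ∫ z, conj z ^ m * z ^ n ∂gaussianMeasure α
      = if m = n then ((n.factorial / α ^ n : ℝ) : ℂ) else 0 := by
  have hi : Integrable (fun z : ℂ => conj z ^ m * z ^ n) (gaussianMeasure α) := by
    simpa using integrable_conj_mul α (memLp_pow hα.out m) (memLp_pow hα.out n)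
  rw [integral_conj_pow_mul hα.out (g := fun z => z ^ n) (by fun_prop) m hi, iteratedDeriv_pow]
  split_ifs with h
  · subst h
    have : (m.factorial : ℂ) ≠ 0 := by exact_mod_cast m.factorial_ne_zero
    simp [Nat.descFactorial_self, this]
  · rcases lt_or_gt_of_ne h with h | h
    · simp [zero_pow (Nat.sub_ne_zero_of_lt h)]
    · simp [Nat.descFactorial_of_lt h]

theorem integral_conj_monomialFun_mul (m n : ℕ) :
    ∫ z, conj (monomialFun α m z) * monomialFun α n z ∂gaussianMeasure α
      = if m = n then 1 else 0 := by
  have : ∀ z, conj (monomialFun α m z) * monomialFun α n z =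
      (Real.sqrt (α ^ m / m.factorial) : ℂ) * Real.sqrt (α ^ n / n.factorial) *
        (conj z ^ m * z ^ n) := by
    intro z; simp only [monomialFun, map_mul, map_pow, Complex.conj_ofReal]; ring
  simp_rw [this]
  rw [integral_const_mul, integral_conj_pow_mul_pow]
  split_ifs with h
  · subst h
    have hp := hα.out
    rw [← Complex.ofReal_mul, ← Complex.ofReal_mul, Real.mul_self_sqrt (by positivity)]
    norm_cast
    field_simp
  · simp

theorem orthonormal_basisVec : Orthonormal ℂ (basisVec α) := by
  rw [orthonormal_iff_ite]
  intro m n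
  rw [Submodule.coe_inner]
  exact (inner_toLp α (memLp_monomialFun hα.out m) (memLp_monomialFun hα.out n)).trans
    (integral_conj_monomialFun_mul α m n)

theorem inner_conjBasisVec (m n : ℕ) :
    inner ℂ (conjBasisVec α m) (conjBasisVec α n) = if m = n then 1 else 0 := by
  refine (inner_toLp α _ _).trans ?_
  have h := congrArg conj (integral_conj_monomialFun_mul α m n)
  rw [← integral_conj] at h
  simp only [map_mul] at h
  rw [h]; split_ifs <;> simp

theorem inner_basisVec_conjBasisVec (m n : ℕ) :
    inner ℂ (basisVec α m : Lp ℂ 2 (gaussianMeasure α)) (conjBasisVec α (n + 1)) = 0 := by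
  refine (inner_toLp α (memLp_monomialFun hα.out m)
    (memLp_conj α (memLp_monomialFun hα.out (n + 1)))).trans ?_
  have h := integral_conj_pow_mul_pow α 0 (m + (n + 1))
  rw [if_neg (by omega)] at h
  have h' := congrArg conj h
  rw [← integral_conj, map_zero] at h'
  have : ∀ z, conj (monomialFun α m z) * conj (monomialFun α (n + 1) z) =
      (Real.sqrt (α ^ m / m.factorial) : ℂ) * Real.sqrt (α ^ (n + 1) / (n + 1).factorial) *
        conj (conj z ^ 0 * z ^ (m + (n + 1))) := by
    intro z
    simp only [monomialFun, map_mul, map_pow, Complex.conj_ofReal, pow_zero, one_mul]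
    ring
  simp_rw [this]
  rw [integral_const_mul, h', mul_zero]

theorem orthonormal_dilationVec : Orthonormal ℂ (dilationVec α) := by
  rw [orthonormal_iff_ite]
  intro m n
  have hb := orthonormal_iff_ite.1 (orthonormal_basisVec α)
  unfold dilationVec
  by_cases h1 : Even m <;> by_cases h2 : Even n <;> simp only [h1, h2, if_true, if_false]
  · refine (hb _ _).trans (if_congr ?_ rfl rfl)
    rw [Nat.even_iff] at h1 h2; omega
  · rw [if_neg (by rintro rfl; exact h2 h1)]
    exact inner_basisVec_conjBasisVec α _ _
  · rw [if_neg (by rintro rfl; exact h1 h2), ← inner_conj_symm, inner_basisVec_conjBasisVec, map_zero]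
  · rw [inner_conjBasisVec]
    refine if_congr ?_ rfl rfl
    rw [Nat.even_iff] at h1 h2; omega

/-- A square summable combination of the `e_n` is an entire function. -/
theorem closure_span_le : (Submodule.span ℂ (Set.range fun n =>
    (basisVec α n : Lp ℂ 2 (gaussianMeasure α)))).topologicalClosure ≤ fockSpace α := by
  have hv : Orthonormal ℂ fun n => (basisVec α n : Lp ℂ 2 (gaussianMeasure α)) :=
    (orthonormal_basisVec α).comp_linearIsometry (fockSpace α).subtypeₗᵢ
  intro f hf
  have hf' : f ∈ LinearMap.range hv.orthogonalFamily.linearIsometry.toLinearMap := by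
    rw [hv.orthogonalFamily.range_linearIsometry]
    convert! hf using 2
    rw [Submodule.span_range_eq_iSup]
    simp_rw [← LinearMap.range_toSpanSingleton]
    rfl
  obtain ⟨c, rfl⟩ := hf'
  have hs := hv.orthogonalFamily.hasSum_linearIsometry c
  set f := hv.orthogonalFamily.linearIsometry c
  have hp := hα.out
  have hc : Summable fun n => ‖c n‖ ^ 2 := by
    simpa using (lp.memℓp c).summable (by norm_num)
  have hb : ∀ R : ℝ, ∀ n : ℕ, ∀ z ∈ Metric.ball (0 : ℂ) R,
      ‖c n * monomialFun α n z‖ ≤ ‖c n‖ ^ 2 + (α * R ^ 2) ^ n / n.factorial := by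
    intro R n z hz
    have hz : ‖z‖ < R := by simpa using hz
    have h1 : ‖monomialFun α n z‖ ^ 2 = (α * ‖z‖ ^ 2) ^ n / n.factorial := by
      simp only [monomialFun, norm_mul, norm_pow, Complex.norm_real, mul_pow]
      rw [Real.norm_of_nonneg (Real.sqrt_nonneg _), Real.sq_sqrt (by positivity)]
      ring
    have h2 : (α * ‖z‖ ^ 2) ^ n / n.factorial ≤ (α * R ^ 2) ^ n / n.factorial := by
      gcongr
    rw [norm_mul]
    nlinarith [sq_nonneg (‖c n‖ - ‖monomialFun α n z‖), sq_nonneg ‖c n‖,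
      sq_nonneg ‖monomialFun α n z‖]
  have hsum : ∀ R : ℝ, Summable fun n : ℕ => ‖c n‖ ^ 2 + (α * R ^ 2) ^ n / n.factorial :=
    fun R => hc.add (Real.summable_pow_div_factorial _)
  have hg : Differentiable ℂ fun z => ∑' n, c n * monomialFun α n z := by
    intro z
    refine (Complex.differentiableOn_tsum_of_summable_norm (hsum (‖z‖ + 1))
      (fun n => ((differentiable_monomialFun α n).const_mul _).differentiableOn)
      Metric.isOpen_ball (hb _)).differentiableAt (Metric.isOpen_ball.mem_nhds ?_)
    simp
  refine ⟨_, hg, ?_⟩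
  have ht := (tendstoInMeasure_of_tendsto_Lp hs.tendsto_sum_nat).exists_seq_tendsto_ae
  obtain ⟨ns, hns, hae⟩ := ht
  have hcoe : ∀ᵐ z ∂gaussianMeasure α, ∀ N : ℕ,
      (∑ n ∈ Finset.range N, LinearIsometry.toSpanSingleton ℂ _ (hv.1 n) (c n) :
        Lp ℂ 2 (gaussianMeasure α)) z = ∑ n ∈ Finset.range N, c n * monomialFun α n z := by
    rw [ae_all_iff]
    intro N
    induction N with
    | zero =>
      filter_upwards [Lp.coeFn_zero ℂ 2 (gaussianMeasure α)] with z hz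
      simpa using hz
    | succ N ih =>
      simp only [Finset.sum_range_succ]
      filter_upwards [ih, Lp.coeFn_add (∑ n ∈ Finset.range N,
        LinearIsometry.toSpanSingleton ℂ _ (hv.1 n) (c n)) (LinearIsometry.toSpanSingleton ℂ _
          (hv.1 N) (c N)), Lp.coeFn_smul (c N) (basisVec α N : Lp ℂ 2 (gaussianMeasure α)),
          (memLp_monomialFun hα.out N).coeFn_toLp] with z h1 h2 h3 h4
      rw [h2, Pi.add_apply, h1]
      congr 1
      refine h3.trans ?_
      rw [Pi.smul_apply, smul_eq_mul]
      congr 1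
  filter_upwards [hae, hcoe] with z h1 h2
  simp only [h2] at h1
  have h3 : Summable fun n => c n * monomialFun α n z :=
    Summable.of_norm_bounded (hsum (‖z‖ + 1)) fun n => hb _ n z (by simp)
  exact tendsto_nhds_unique h1 (h3.hasSum.tendsto_sum_nat.comp hns.tendsto_atTop)

/-- An element of the Fock space that is orthogonal to every `e_n` vanishes. -/
theorem eq_zero_of_inner_basisVec {f : Lp ℂ 2 (gaussianMeasure α)} (hf : f ∈ fockSpace α)
    (h : ∀ n, inner ℂ (basisVec α n : Lp ℂ 2 (gaussianMeasure α)) f = 0) : f = 0 := by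
  obtain ⟨g, hg, hfg⟩ := hf
  have hgL : MemLp g 2 (gaussianMeasure α) := (memLp_congr_ae hfg).1 (Lp.memLp f)
  have hfe : f = hgL.toLp g := by
    apply Lp.ext
    exact hfg.trans hgL.coeFn_toLp.symm
  have hp := hα.out
  have hd : ∀ n, iteratedDeriv n g 0 = 0 := by
    intro n
    have h1 := h n
    rw [hfe] at h1
    have h2 := (inner_toLp α (memLp_monomialFun hα.out n) hgL).symm.trans h1
    have h3 : ∀ z, conj (monomialFun α n z) * g z =
        (Real.sqrt (α ^ n / n.factorial) : ℂ) * (conj z ^ n * g z) := by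
      intro z; simp only [monomialFun, map_mul, map_pow, Complex.conj_ofReal]; ring
    simp_rw [h3] at h2
    have hi : Integrable (fun z : ℂ => conj z ^ n * g z) (gaussianMeasure α) := by
      simpa using integrable_conj_mul α (memLp_pow hα.out n) hgL
    rw [integral_const_mul, integral_conj_pow_mul hα.out hg n hi] at h2
    have h4 : (Real.sqrt (α ^ n / n.factorial) : ℂ) ≠ 0 := by
      exact_mod_cast (Real.sqrt_pos.2 (by positivity)).ne'
    have h5 : ((n.factorial / α ^ n : ℝ) : ℂ) ≠ 0 := by
      exact_mod_cast (by positivity : (n.factorial / α ^ n : ℝ) ≠ 0)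
    have h6 : (n.factorial : ℂ) ≠ 0 := by exact_mod_cast n.factorial_ne_zero
    rcases mul_eq_zero.1 h2 with h7 | h7
    · exact absurd h7 h4
    · rcases mul_eq_zero.1 h7 with h8 | h8
      · exact (div_eq_zero_iff.1 h8).resolve_right h6
      · exact absurd h8 h5
  have h0 : g = 0 := by
    ext z
    rw [← Complex.taylorSeries_eq_of_entire' 0 z hg]
    simp [hd]
  rw [hfe]
  apply Lp.ext
  filter_upwards [hgL.coeFn_toLp, Lp.coeFn_zero ℂ 2 (gaussianMeasure α)] with z h1 h2
  rw [h1, h2, h0]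

theorem fockSpace_eq_closure : fockSpace α = (Submodule.span ℂ (Set.range fun n =>
    (basisVec α n : Lp ℂ 2 (gaussianMeasure α)))).topologicalClosure := by
  refine le_antisymm (fun f hf => ?_) (closure_span_le α)
  set V := (Submodule.span ℂ (Set.range fun n =>
    (basisVec α n : Lp ℂ 2 (gaussianMeasure α)))).topologicalClosure
  have : CompleteSpace V :=
    (Submodule.isClosed_topologicalClosure _).completeSpace_coe
  have h1 : f - V.starProjection f ∈ fockSpace α :=
    (fockSpace α).sub_mem hf (closure_span_le α (V.starProjection_apply_mem f))
  have h2 : f - V.starProjection f = 0 := by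
    refine eq_zero_of_inner_basisVec α h1 fun n => ?_
    exact (V.sub_starProjection_mem_orthogonal f) _
      (Submodule.le_topologicalClosure _ (Submodule.subset_span ⟨n, rfl⟩))
  rw [sub_eq_zero.1 h2]
  exact V.starProjection_apply_mem f

instance completeSpace_fockSpace : CompleteSpace (fockSpace α) := by
  rw [fockSpace_eq_closure]
  exact (Submodule.isClosed_topologicalClosure _).completeSpace_coe

/-- The orthonormal basis `(e_n)` of the Fock space. -/
def fockBasis : HilbertBasis ℕ ℂ (fockSpace α) :=
  HilbertBasis.mkOfOrthogonalEqBot (orthonormal_basisVec α) (by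
    rw [eq_bot_iff]
    intro f hf
    rw [Submodule.mem_bot, ← Submodule.coe_eq_zero]
    exact eq_zero_of_inner_basisVec α f.2 fun n =>
      hf _ (Submodule.subset_span ⟨n, rfl⟩))

theorem fockBasis_apply (n : ℕ) : fockBasis α n = basisVec α n := by
  simp [fockBasis]

/-- The dilation operator `K : F_α² → L²(ℂ, dλ_α)`, the isometry with `K e_{2n} = e_n` and
`K e_{2n+1} = \overline{e_{n+1}}`. -/
def dilation : fockSpace α →L[ℂ] Lp ℂ 2 (gaussianMeasure α) :=
  ((orthonormal_dilationVec α).orthogonalFamily.linearIsometry.comp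
    (fockBasis α).repr.toLinearIsometry).toContinuousLinearMap

theorem dilation_basisVec (n : ℕ) : dilation α (basisVec α n) = dilationVec α n := by
  rw [← fockBasis_apply]
  simp [dilation, HilbertBasis.repr_self]

theorem dilation_basisVec_even (n : ℕ) : dilation α (basisVec α (2 * n)) = basisVec α n := by
  rw [dilation_basisVec, dilationVec, if_pos (by simp)]
  simp

theorem dilation_basisVec_odd (n : ℕ) :
    dilation α (basisVec α (2 * n + 1)) = conjBasisVec α (n + 1) := by
  rw [dilation_basisVec, dilationVec, if_neg (by simp)]
  congr 2
  omega

end Basis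

section Operators

variable (α : ℝ)

theorem memLp_top_gaussian {φ : ℂ → ℂ} (hφ : MemLp φ ∞ volume) :
    MemLp φ ∞ (gaussianMeasure α) := by
  refine ⟨hφ.1.mono_ac (gaussianMeasure_ac α), ?_⟩
  have h := hφ.2
  rw [eLpNorm_exponent_top] at h ⊢
  exact (eLpNormEssSup_mono_measure φ (gaussianMeasure_ac α)).trans_lt h

/-- The operator `M_φ` of multiplication by `φ ∈ L^∞(ℂ)` on `L²(ℂ, dλ_α)`. -/
def mulOp (φ : ℂ → ℂ) (hφ : MemLp φ ∞ volume) :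
    Lp ℂ 2 (gaussianMeasure α) →L[ℂ] Lp ℂ 2 (gaussianMeasure α) :=
  (ContinuousLinearMap.mul ℂ ℂ).holderL (gaussianMeasure α) ∞ 2 2
    ((memLp_top_gaussian α hφ).toLp φ)

theorem coeFn_mulOp (φ : ℂ → ℂ) (hφ : MemLp φ ∞ volume) (f : Lp ℂ 2 (gaussianMeasure α)) :
    mulOp α φ hφ f =ᵐ[gaussianMeasure α] fun w => φ w * f w := by
  have h := (ContinuousLinearMap.mul ℂ ℂ).coeFn_holder (r := 2)
    ((memLp_top_gaussian α hφ).toLp φ) f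
  filter_upwards [h, (memLp_top_gaussian α hφ).coeFn_toLp] with w h1 h2
  refine h1.trans ?_
  rw [ContinuousLinearMap.mul_apply', h2]

variable [hα : Fact (0 < α)]

/-- The H-Toeplitz operator `S_φ = P M_φ K` on the Fock space, where `P` is the orthogonal
projection of `L²(ℂ, dλ_α)` onto the Fock space. -/
def hToeplitz (φ : ℂ → ℂ) (hφ : MemLp φ ∞ volume) : fockSpace α →L[ℂ] fockSpace α :=
  (fockSpace α).orthogonalProjectionOnto ∘L mulOp α φ hφ ∘L dilation α

/-- The reproducing kernel `K_z` as an element of the Fock space. -/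
def kernelVec (z : ℂ) : fockSpace α :=
  ⟨(memLp_kernelFun hα.out z).toLp _,
    toLp_mem_fockSpace (differentiable_kernelFun α z) (memLp_kernelFun hα.out z)⟩

/-- The normalized reproducing kernel `k_z = K_z / ‖K_z‖`. -/
def normKernelVec (z : ℂ) : fockSpace α := ((‖kernelVec α z‖ : ℂ))⁻¹ • kernelVec α z

/-- The Berezin transform `z ↦ ⟨T k_z, k_z⟩` of an operator `T`; Mathlib's inner product is
conjugate-linear in its first argument. -/
def berezin (T : fockSpace α →L[ℂ] fockSpace α) (z : ℂ) : ℂ :=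
  inner ℂ (normKernelVec α z) (T (normKernelVec α z))

/-- The kernel function `I(z, w) = K(k_z)(w)`. For each `z` this is an element of `L²(ℂ, dλ_α)`,
so it is determined for almost every `w`. -/
def dilatedKernel (z w : ℂ) : ℂ := dilation α (normKernelVec α z) w

end Operators

end HToeplitz

end

/-! The integral formula follows from the reproducing kernel: `K_z` lies in the Fock space, so the
projection disappears from the pairing `⟨P(φ K k_z), k_z⟩`. What remains is an `L²` pairing against
the conjugate of `K_z`, divided by `‖K_z‖ = e^{α|z|²/2}`.

The decay holds because `K` halves degrees. Put `m = α|z|²` and expand `K_z = ∑ conj(e_n(z)) e_n`.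
The weights `e_n(z)` favour `n` near `m`, and `|K e_n| = |e_k|` with `k` about `n/2`. After Gaussian
weighting, `|e_k|` is concentrated near `|w|² = k/α`, that is, near `|w|² = |z|²/2`, whereas `K_z`
is concentrated near `w = z`. The overlap is therefore exponentially small.

To quantify this, Cauchy-Schwarz is applied with unequal Gaussian weights `β = (1+t)α` for `K_z` and
`γ = (1-t)α` for `e_k` (`integral_norm_mul_norm_le`). The kernel then contributes `exp(m /
(2(1+t)))`, a gain, and `e_k` contributes `(1-t)^{-(k+1)/2}`, a loss. Since `k` is about `n/2`,
summing the loss against `|e_n(z)|` costs about `exp(m / (2√(1-t)))`. To first order in `t` the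
total exponent is `(1 - t/4) m`, below the `m` removed by the two normalizations. Without the
halving, the loss would be `exp(m / (2(1-t)))`, and nothing would be gained. With `t = 19/100` and
some slack in the sum, the bound is `C e^{-m/119}` (`norm_berezin_hToeplitz_le`). -/

namespace HToeplitz

/-! ### Change of Gaussian parameter and weighted Cauchy-Schwarz -/

theorem integral_gaussianMeasure_real {α : ℝ} (hα : 0 < α) (f : ℂ → ℝ) :
    ∫ z, f z ∂gaussianMeasure α = ∫ z, gaussianDensity α z * f z := by
  unfold gaussianMeasure
  rw [integral_withDensity_eq_integral_toReal_smul
    (continuous_gaussianDensity α).measurable.ennreal_ofReal (by simp)]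
  simp [ENNReal.toReal_ofReal (gaussianDensity_pos hα _).le]

theorem gaussianDensity_mul_exp {α β : ℝ} (hβ : 0 < β) (z : ℂ) :
    gaussianDensity α z * Real.exp ((α - β) * ‖z‖ ^ 2) = α / β * gaussianDensity β z := by
  unfold gaussianDensity
  rw [mul_assoc, ← Real.exp_add, show -α * ‖z‖ ^ 2 + (α - β) * ‖z‖ ^ 2 = -β * ‖z‖ ^ 2 by ring]
  field_simp

/-- Passing from `λ_β` to `λ_α` by means of the weight `e^{(α - β) |z|²}`. -/
theorem integral_mul_exp {α β : ℝ} (hα : 0 < α) (hβ : 0 < β) (f : ℂ → ℝ) :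
    ∫ z, f z * Real.exp ((α - β) * ‖z‖ ^ 2) ∂gaussianMeasure α
      = α / β * ∫ z, f z ∂gaussianMeasure β := by
  rw [integral_gaussianMeasure_real hα, integral_gaussianMeasure_real hβ, ← integral_const_mul]
  congr 1 with z
  linear_combination f z * gaussianDensity_mul_exp (α := α) hβ z

theorem integrable_mul_exp {α β : ℝ} (hα : 0 < α) (hβ : 0 < β) {f : ℂ → ℝ}
    (hf : Integrable f (gaussianMeasure β)) :
    Integrable (fun z => f z * Real.exp ((α - β) * ‖z‖ ^ 2)) (gaussianMeasure α) := by
  rw [integrable_gaussianMeasure_iff hα]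
  refine (((integrable_gaussianMeasure_iff hβ f).1 hf).const_mul (α / β)).congr
    (ae_of_all _ fun z => ?_)
  simp only [smul_eq_mul]
  linear_combination -f z * gaussianDensity_mul_exp (α := α) hβ z

/-- The Cauchy-Schwarz inequality with a Gaussian weight. -/
theorem integral_norm_mul_norm_le {α β γ : ℝ} (hβ : 0 < β) (hγ : 0 < γ)
    (hα : β + γ = 2 * α) {f g : ℂ → ℂ} (hf : Continuous f) (hg : Continuous g)
    (hfi : MemLp f 2 (gaussianMeasure β)) (hgi : MemLp g 2 (gaussianMeasure γ)) :
    ∫ z, ‖f z‖ * ‖g z‖ ∂gaussianMeasure α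
      ≤ Real.sqrt (α / β * ∫ z, ‖f z‖ ^ 2 ∂gaussianMeasure β) *
        Real.sqrt (α / γ * ∫ z, ‖g z‖ ^ 2 ∂gaussianMeasure γ) := by
  have hα0 : 0 < α := by linarith
  -- The factors are multiplied by `e^{(α-β)|z|²/2}` and `e^{(α-γ)|z|²/2}`. These cancel because `β
  -- + γ = 2α`, and their squares turn `λ_α` into multiples of `λ_β` and `λ_γ`.
  have key : ∀ {δ : ℝ} {h : ℂ → ℂ} (z : ℂ),
      (‖h z‖ * Real.exp ((α - δ) / 2 * ‖z‖ ^ 2)) ^ 2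
        = ‖h z‖ ^ 2 * Real.exp ((α - δ) * ‖z‖ ^ 2) := by
    intro δ h z
    rw [mul_pow, ← Real.exp_nat_mul]
    congr 2
    push_cast; ring
  have hL : ∀ {δ : ℝ} {h : ℂ → ℂ}, 0 < δ → Continuous h → MemLp h 2 (gaussianMeasure δ) →
      MemLp (fun z => ‖h z‖ * Real.exp ((α - δ) / 2 * ‖z‖ ^ 2)) (ENNReal.ofReal 2)
        (gaussianMeasure α) := by
    intro δ h hδ hc hh
    rw [show ENNReal.ofReal 2 = 2 by simp,
      memLp_two_iff_integrable_sq (by fun_prop : Continuous _).aestronglyMeasurable]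
    simp_rw [key]
    exact integrable_mul_exp hα0 hδ ((memLp_two_iff_integrable_sq_norm hh.1).1 hh)
  have hH := integral_mul_le_Lp_mul_Lq_of_nonneg (p := 2) (q := 2)
    (by constructor <;> norm_num) (ae_of_all _ fun z => by positivity)
    (ae_of_all _ fun z => by positivity) (hL hβ hf hfi) (hL hγ hg hgi)
  simp only [Real.rpow_two, key, integral_mul_exp hα0 hβ, integral_mul_exp hα0 hγ,
    ← Real.sqrt_eq_rpow] at hH
  refine le_trans (le_of_eq ?_) hH
  congr 1 with z
  have : Real.exp ((α - β) / 2 * ‖z‖ ^ 2) * Real.exp ((α - γ) / 2 * ‖z‖ ^ 2) = 1 := by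
    rw [← Real.exp_add, Real.exp_eq_one_iff]
    linear_combination -(‖z‖ ^ 2 / 2) * hα
  linear_combination -(‖f z‖ * ‖g z‖) * this

/-! ### Norms of `e_n` and `K_z` for a different Gaussian parameter -/

/-- The `2n`-th absolute moment of `λ_β` is `n!/β^n`. For `β < α` this gives the geometric loss in
the decay estimate. -/
theorem integral_norm_sq_monomialFun {α β : ℝ} (hα : 0 < α) (hβ : 0 < β) (n : ℕ) :
    ∫ z, ‖monomialFun α n z‖ ^ 2 ∂gaussianMeasure β = (α / β) ^ n := by
  have : Fact (0 < β) := ⟨hβ⟩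
  have h1 := integral_conj_pow_mul_pow β n n
  have h2 : ∀ z : ℂ, conj z ^ n * z ^ n = ((‖z‖ ^ (2 * n) : ℝ) : ℂ) := by
    intro z
    rw [← mul_pow, mul_comm, Complex.mul_conj, Complex.normSq_eq_norm_sq, pow_mul]; push_cast; rfl
  simp only [h2, if_true, integral_complex_ofReal] at h1
  have h3 := Complex.ofReal_injective h1
  have h4 : ∀ z : ℂ, ‖monomialFun α n z‖ ^ 2 = α ^ n / n.factorial * ‖z‖ ^ (2 * n) := by
    intro z
    simp only [monomialFun, norm_mul, norm_pow, Complex.norm_real, mul_pow]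
    rw [Real.norm_of_nonneg (Real.sqrt_nonneg _), Real.sq_sqrt (by positivity)]
    ring
  simp_rw [h4]
  rw [integral_const_mul, h3]
  have : (n.factorial : ℝ) ≠ 0 := by exact_mod_cast n.factorial_ne_zero
  rw [div_pow]
  field_simp

/-- Since `|K_z(w)|² = e^{2α⟨z,w⟩}` for the real inner product, this is a Gaussian integral with a
linear term. For `β > α` the exponent falls below `α|z|²`, which is the gain in the decay estimate.
-/
theorem integral_norm_sq_kernelFun (α : ℝ) {β : ℝ} (hβ : 0 < β) (z : ℂ) :
    ∫ w, ‖kernelFun α z w‖ ^ 2 ∂gaussianMeasure β = Real.exp (α ^ 2 * ‖z‖ ^ 2 / β) := by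
  have h := GaussianFourier.integral_cexp_neg_mul_sq_norm_add (b := (β : ℂ)) (V := ℂ)
    (by simpa using hβ) ((2 * α : ℝ) : ℂ) z
  rw [integral_gaussianMeasure_real hβ]
  apply Complex.ofReal_injective
  have hw : ∀ w : ℂ, ((gaussianDensity β w * ‖kernelFun α z w‖ ^ 2 : ℝ) : ℂ)
      = (β / Real.pi : ℂ) *
        Complex.exp (-β * ‖w‖ ^ 2 + ((2 * α : ℝ) : ℂ) * ((inner ℝ z w : ℝ) : ℂ)) := by
    intro w
    have : ‖kernelFun α z w‖ ^ 2 = Real.exp (2 * α * inner ℝ z w) := by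
      rw [kernelFun, Complex.norm_exp, ← Real.exp_nat_mul, mul_assoc, Complex.re_ofReal_mul,
        Complex.inner]
      push_cast
      ring_nf
    rw [this, gaussianDensity, mul_assoc, ← Real.exp_add]
    push_cast
    ring_nf
  rw [← integral_complex_ofReal]
  simp_rw [hw]
  rw [integral_const_mul, h]
  have hb : (β : ℂ) ≠ 0 := by exact_mod_cast hβ.ne'
  have hp : (Real.pi : ℂ) ≠ 0 := by exact_mod_cast Real.pi_pos.ne'
  rw [Complex.finrank_real_complex]
  simp only [Nat.cast_ofNat, div_self (two_ne_zero' ℂ), Complex.cpow_one]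
  push_cast
  rw [← mul_assoc, div_mul_div_cancel₀ hp, div_self hb, one_mul]
  congr 1
  field_simp
  ring

theorem memLp_kernelFun_of_pos (α : ℝ) {β : ℝ} (hβ : 0 < β) (z : ℂ) :
    MemLp (kernelFun α z) 2 (gaussianMeasure β) := by
  -- The kernel with parameter `α` at `z` is the kernel with parameter `β` at `αz/β`.
  have : kernelFun α z = kernelFun β (α / β * z) := by
    have hb : (β : ℂ) ≠ 0 := by exact_mod_cast hβ.ne'
    ext w
    simp only [kernelFun, map_mul, map_div₀, Complex.conj_ofReal]
    field_simp
  rw [this]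
  exact memLp_kernelFun hβ _

theorem conj_kernelFun (α : ℝ) (z w : ℂ) : conj (kernelFun α z w) = Complex.exp (α * z * conj w) := by
  rw [kernelFun, ← Complex.exp_conj]
  simp

/-! ### Reproducing kernel pairings and the integral formula -/

section

variable (α : ℝ) [hα : Fact (0 < α)]

theorem norm_kernelVec (z : ℂ) : ‖kernelVec α z‖ = Real.exp (α * ‖z‖ ^ 2 / 2) := by
  have h1 : ((‖kernelVec α z‖ ^ 2 : ℝ) : ℂ) = ((Real.exp (α * ‖z‖ ^ 2) : ℝ) : ℂ) := by
    have h2 := integral_norm_sq_kernelFun α hα.out z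
    rw [show α ^ 2 * ‖z‖ ^ 2 / α = α * ‖z‖ ^ 2 by have := hα.out; field_simp] at h2
    rw [← h2, ← integral_complex_ofReal, Complex.ofReal_pow]
    refine (inner_self_eq_norm_sq_to_K (𝕜 := ℂ) (kernelVec α z)).symm.trans ?_
    refine (inner_toLp α (memLp_kernelFun hα.out z) (memLp_kernelFun hα.out z)).trans ?_
    congr 1 with w
    rw [mul_comm, Complex.mul_conj, Complex.normSq_eq_norm_sq]
  have h3 := Complex.ofReal_injective h1
  rw [← Real.sqrt_sq (norm_nonneg (kernelVec α z)), h3, ← Real.exp_half]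

/-- Pairing with `w^n` extracts the `n`-th Taylor coefficient of `K_z`, which is `(α conj z)^n /
n!`. These are the coefficients of `K_z` in the basis `e_n`. -/
theorem inner_basisVec_kernelVec (n : ℕ) (z : ℂ) :
    inner ℂ (basisVec α n) (kernelVec α z) = conj (monomialFun α n z) := by
  have hp := hα.out
  refine (inner_toLp α (memLp_monomialFun hα.out n) (memLp_kernelFun hα.out z)).trans ?_
  have h3 : ∀ w, conj (monomialFun α n w) * kernelFun α z w =
      (Real.sqrt (α ^ n / n.factorial) : ℂ) * (conj w ^ n * kernelFun α z w) := by
    intro w; simp only [monomialFun, map_mul, map_pow, Complex.conj_ofReal]; ring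
  simp_rw [h3]
  have hi : Integrable (fun w : ℂ => conj w ^ n * kernelFun α z w) (gaussianMeasure α) := by
    simpa using integrable_conj_mul α (memLp_pow hα.out n) (memLp_kernelFun hα.out z)
  rw [integral_const_mul, integral_conj_pow_mul hα.out (differentiable_kernelFun α z) n hi]
  have h4 : iteratedDeriv n (kernelFun α z) 0 = (α * conj z) ^ n := by
    refine (congrFun (iteratedDeriv_cexp_const_mul n (α * conj z)) 0).trans ?_
    rw [mul_zero, Complex.exp_zero, mul_one]
  have h6 : (n.factorial : ℂ) ≠ 0 := by exact_mod_cast n.factorial_ne_zero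
  have h7 : (α : ℂ) ≠ 0 := by exact_mod_cast hp.ne'
  rw [h4, monomialFun, map_mul, map_pow, Complex.conj_ofReal, mul_pow]
  congr 1
  push_cast
  field_simp

/-- The pairing `⟨φ f, K_z⟩` is an absolutely convergent integral. -/
theorem integrable_mul_conj_kernelFun (φ : ℂ → ℂ) (hφ : MemLp φ ∞ volume)
    (f : Lp ℂ 2 (gaussianMeasure α)) (z : ℂ) :
    Integrable (fun w => φ w * f w * Complex.exp (α * z * conj w)) (gaussianMeasure α) := by
  have h1 : MemLp (fun w => φ w * f w) 2 (gaussianMeasure α) :=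
    (memLp_congr_ae (coeFn_mulOp α φ hφ f)).1 (Lp.memLp _)
  refine (integrable_conj_mul α (memLp_kernelFun hα.out z) h1).congr (ae_of_all _ fun w => ?_)
  simp only [conj_kernelFun]
  ring

theorem inner_kernelVec_mulOp (φ : ℂ → ℂ) (hφ : MemLp φ ∞ volume)
    (f : Lp ℂ 2 (gaussianMeasure α)) (z : ℂ) :
    inner ℂ (kernelVec α z : Lp ℂ 2 (gaussianMeasure α)) (mulOp α φ hφ f)
      = ∫ w, φ w * f w * Complex.exp (α * z * conj w) ∂gaussianMeasure α := by
  rw [L2.inner_def]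
  refine integral_congr_ae ?_
  filter_upwards [(memLp_kernelFun hα.out z).coeFn_toLp, coeFn_mulOp α φ hφ f] with w h1 h2
  rw [h2, RCLike.inner_apply, ← conj_kernelFun, ← h1]
  rfl

/-- The projection fixes the left vector and can be dropped. Only the left normalization is
extracted; the right one stays inside `k_z`, as in `I(z, w)`. -/
theorem berezin_hToeplitz (φ : ℂ → ℂ) (hφ : MemLp φ ∞ volume) (z : ℂ) :
    berezin α (hToeplitz α φ hφ) z = Complex.exp (-(α * (‖z‖ : ℂ) ^ 2 / 2)) *
      inner ℂ (kernelVec α z : Lp ℂ 2 (gaussianMeasure α))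
        (mulOp α φ hφ (dilation α (normKernelVec α z))) := by
  have h : conj (((‖kernelVec α z‖ : ℂ))⁻¹) = Complex.exp (-(α * (‖z‖ : ℂ) ^ 2 / 2)) := by
    rw [map_inv₀, Complex.conj_ofReal, norm_kernelVec, Complex.exp_neg]
    push_cast
    rfl
  rw [berezin, ← h]
  refine ((fockSpace α).inner_orthogonalProjectionOnto_eq_of_mem_left _ _).trans ?_
  rw [normKernelVec, Submodule.coe_smul, inner_smul_left]
  rfl

/-! ### Termwise estimates and Gaussian decay -/

/-- Only moduli matter against a bounded symbol, and conjugation does not change them. The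
inequality `2k ≤ n + 1` records the halving of degrees on which the decay rests. -/
theorem dilationVec_ae_eq (n : ℕ) : ∃ k : ℕ, 2 * k ≤ n + 1 ∧
    ∀ᵐ w ∂gaussianMeasure α, ‖dilationVec α n w‖ = ‖monomialFun α k w‖ := by
  rcases Nat.even_or_odd n with h | h
  · refine ⟨n / 2, by omega, ?_⟩
    filter_upwards [(memLp_monomialFun hα.out (n / 2)).coeFn_toLp] with w hw
    rw [dilationVec, if_pos h, ← hw]
    rfl
  · refine ⟨n / 2 + 1, by rw [Nat.odd_iff] at h; omega, ?_⟩
    filter_upwards [(memLp_conj α (memLp_monomialFun hα.out (n / 2 + 1))).coeFn_toLp] with w hw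
    rw [dilationVec, if_neg (Nat.not_even_iff_odd.2 h), conjBasisVec, hw, RCLike.norm_conj]

/-- Weighted Cauchy-Schwarz with `β = 119α/100` and `γ = 81α/100`. The value `81/100` is a perfect
square, so `α/γ = (10/9)²`; the prefactor `α/γ` accounts for the `+ 2` in the exponent. -/
theorem integral_norm_kernelFun_mul_norm_monomialFun_le (z : ℂ) (k : ℕ) :
    ∫ w, ‖kernelFun α z w‖ * ‖monomialFun α k w‖ ∂gaussianMeasure α
      ≤ Real.exp (50 / 119 * (α * ‖z‖ ^ 2)) * Real.sqrt ((10 / 9) ^ (2 * k + 2)) := by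
  have hp := hα.out
  have hβ : 0 < 119 / 100 * α := by positivity
  have hγ : 0 < 81 / 100 * α := by positivity
  refine (integral_norm_mul_norm_le hβ hγ (by ring) (differentiable_kernelFun α z).continuous
    (differentiable_monomialFun α k).continuous (memLp_kernelFun_of_pos α hβ z)
    ((memLp_pow hγ k).const_mul _)).trans ?_
  rw [integral_norm_sq_kernelFun α hβ, integral_norm_sq_monomialFun hp hγ]
  have h1 : α / (119 / 100 * α) = 100 / 119 := by field_simp
  have h2 : α / (81 / 100 * α) = (10 / 9) ^ 2 := by field_simp; norm_num
  have h3 : α ^ 2 * ‖z‖ ^ 2 / (119 / 100 * α) = 100 / 119 * (α * ‖z‖ ^ 2) := by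
    field_simp
  rw [h1, h2, h3, ← pow_mul, ← pow_add, add_comm 2]
  refine mul_le_mul_of_nonneg_right ?_ (Real.sqrt_nonneg _)
  rw [show 50 / 119 * (α * ‖z‖ ^ 2) = 100 / 119 * (α * ‖z‖ ^ 2) / 2 by ring, Real.exp_half]
  -- The prefactor `α/β = 100/119` is less than `1` and is discarded.
  refine Real.sqrt_le_sqrt ?_
  have := Real.exp_pos (100 / 119 * (α * ‖z‖ ^ 2))
  linarith

theorem norm_inner_kernelVec_mulOp_dilationVec_le (φ : ℂ → ℂ) (hφ : MemLp φ ∞ volume) (z : ℂ)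
    (n : ℕ) :
    ‖inner ℂ (kernelVec α z : Lp ℂ 2 (gaussianMeasure α)) (mulOp α φ hφ (dilationVec α n))‖
      ≤ (eLpNorm φ ∞ volume).toReal *
        (Real.exp (50 / 119 * (α * ‖z‖ ^ 2)) * Real.sqrt ((10 / 9) ^ (n + 3))) := by
  obtain ⟨k, hk, hae⟩ := dilationVec_ae_eq α n
  have hM : ∀ᵐ w ∂gaussianMeasure α, ‖φ w‖ ≤ (eLpNorm φ ∞ volume).toReal := by
    refine gaussianMeasure_ac α ?_
    have := hφ.2.ne
    rw [eLpNorm_exponent_top] at this ⊢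
    filter_upwards [enorm_ae_le_eLpNormEssSup φ volume] with w hw
    simpa using ENNReal.toReal_mono this hw
  rw [inner_kernelVec_mulOp]
  have hi : Integrable (fun w => ‖kernelFun α z w‖ * ‖monomialFun α k w‖) (gaussianMeasure α) :=
    (memLp_kernelFun hα.out z).norm.integrable_mul (memLp_monomialFun hα.out k).norm
  refine (norm_integral_le_of_norm_le (hi.const_mul (eLpNorm φ ∞ volume).toReal) ?_).trans ?_
  · filter_upwards [hae, hM] with w h1 h2
    rw [norm_mul, norm_mul, h1, ← conj_kernelFun, RCLike.norm_conj, mul_assoc,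
      mul_comm ‖kernelFun α z w‖]
    exact mul_le_mul_of_nonneg_right h2 (by positivity)
  · rw [integral_const_mul]
    refine mul_le_mul_of_nonneg_left ?_ ENNReal.toReal_nonneg
    refine (integral_norm_kernelFun_mul_norm_monomialFun_le α z k).trans ?_
    refine mul_le_mul_of_nonneg_left (Real.sqrt_le_sqrt ?_) (Real.exp_pos _).le
    -- The exponent `n + 3` comes from `2k + 2 ≤ (n + 1) + 2`.
    exact pow_le_pow_right₀ (by norm_num) (by omega)

/-- After squaring, `(10m/9)^n / n!` with `m = α|z|²` is bounded by a single term of the series of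
`e^{8m/7}`. Taking `8/7` slightly above `10/9` leaves the ratio `(10/9)/(8/7) = 35/36`, so the
bounds are summable in `n`. -/
theorem norm_monomialFun_mul_sqrt_le (z : ℂ) (n : ℕ) :
    ‖monomialFun α n z‖ * Real.sqrt ((10 / 9) ^ (n + 3))
      ≤ 2 * Real.exp (4 / 7 * (α * ‖z‖ ^ 2)) * Real.sqrt (35 / 36) ^ n := by
  have hp := hα.out
  have h1 : ‖monomialFun α n z‖ = Real.sqrt ((α * ‖z‖ ^ 2) ^ n / n.factorial) := by
    rw [← Real.sqrt_sq (norm_nonneg (monomialFun α n z))]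
    simp only [monomialFun, norm_mul, norm_pow, Complex.norm_real, mul_pow]
    rw [Real.norm_of_nonneg (Real.sqrt_nonneg _), Real.sq_sqrt (by positivity)]
    ring_nf
  have h2 : 2 * Real.exp (4 / 7 * (α * ‖z‖ ^ 2)) * Real.sqrt (35 / 36) ^ n
      -- The constant `4` is a convenient square above `(10/9)³`.
      = Real.sqrt (4 * Real.exp (8 / 7 * (α * ‖z‖ ^ 2)) * (35 / 36) ^ n) := by
    symm
    rw [Real.sqrt_eq_iff_eq_sq (by positivity) (by positivity), mul_pow, mul_pow,
      ← Real.exp_nat_mul, pow_right_comm, Real.sq_sqrt (by norm_num)]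
    push_cast
    ring_nf
  rw [h1, h2, ← Real.sqrt_mul (by positivity)]
  refine Real.sqrt_le_sqrt ?_
  have h3 := Real.pow_div_factorial_le_exp (8 / 7 * (α * ‖z‖ ^ 2)) (by positivity) n
  calc (α * ‖z‖ ^ 2) ^ n / n.factorial * (10 / 9) ^ (n + 3)
      = (10 / 9) ^ 3 * ((8 / 7 * (α * ‖z‖ ^ 2)) ^ n / n.factorial) * (35 / 36) ^ n := by
        have h4 : (10 / 9 : ℝ) ^ n = (8 / 7) ^ n * (35 / 36) ^ n := by
          rw [← mul_pow]; norm_num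
        rw [pow_add, h4, mul_pow (8 / 7) (α * ‖z‖ ^ 2)]
        ring
    _ ≤ 4 * Real.exp (8 / 7 * (α * ‖z‖ ^ 2)) * (35 / 36) ^ n := by
        gcongr
        norm_num

/-- The Berezin transform of an H-Toeplitz operator has Gaussian decay. -/
theorem norm_berezin_hToeplitz_le (φ : ℂ → ℂ) (hφ : MemLp φ ∞ volume) :
    ∃ C : ℝ, ∀ z : ℂ, ‖berezin α (hToeplitz α φ hφ) z‖
      ≤ C * Real.exp (-(1 / 119) * (α * ‖z‖ ^ 2)) := by
  set M := (eLpNorm φ ∞ volume).toReal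
  set ρ := Real.sqrt (35 / 36)
  have hρ : ρ < 1 := by
    rw [Real.sqrt_lt' one_pos]; norm_num
  refine ⟨M * 2 * (1 - ρ)⁻¹, fun z => ?_⟩
  set m := α * ‖z‖ ^ 2 with hm
  have hs : HasSum (fun n => conj (monomialFun α n z) *
      inner ℂ (kernelVec α z : Lp ℂ 2 (gaussianMeasure α)) (mulOp α φ hφ (dilationVec α n)))
      (inner ℂ (kernelVec α z : Lp ℂ 2 (gaussianMeasure α))
        (mulOp α φ hφ (dilation α (kernelVec α z)))) := by
    -- The expansion of `K_z` in the basis `e_n` is pushed through the continuous functional `f ↦ ⟨φ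
    -- K f, K_z⟩`.
    have h := ((fockBasis α).hasSum_repr (kernelVec α z)).mapL
      (innerSL ℂ (kernelVec α z : Lp ℂ 2 (gaussianMeasure α)) ∘L mulOp α φ hφ ∘L dilation α)
    simp only [HilbertBasis.repr_apply_apply, fockBasis_apply, inner_basisVec_kernelVec, map_smul,
      ContinuousLinearMap.comp_apply, dilation_basisVec, smul_eq_mul, innerSL_apply_apply] at h
    exact h
  have hb : ‖inner ℂ (kernelVec α z : Lp ℂ 2 (gaussianMeasure α))
      (mulOp α φ hφ (dilation α (kernelVec α z)))‖
      ≤ M * (Real.exp (50 / 119 * m)) * (2 * Real.exp (4 / 7 * m)) * (1 - ρ)⁻¹ := by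
    rw [← hs.tsum_eq]
    refine tsum_of_norm_bounded ((hasSum_geometric_of_lt_one (Real.sqrt_nonneg _) hρ).mul_left _)
      fun n => ?_
    rw [norm_mul, RCLike.norm_conj]
    calc _ ≤ ‖monomialFun α n z‖ * (M * (Real.exp (50 / 119 * m) *
            Real.sqrt ((10 / 9) ^ (n + 3)))) :=
          mul_le_mul_of_nonneg_left (norm_inner_kernelVec_mulOp_dilationVec_le α φ hφ z n)
            (norm_nonneg _)
      _ = M * Real.exp (50 / 119 * m) *
            (‖monomialFun α n z‖ * Real.sqrt ((10 / 9) ^ (n + 3))) := by ring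
      _ ≤ M * Real.exp (50 / 119 * m) * (2 * Real.exp (4 / 7 * m) * ρ ^ n) :=
          mul_le_mul_of_nonneg_left (norm_monomialFun_mul_sqrt_le α z n)
            (mul_nonneg ENNReal.toReal_nonneg (Real.exp_pos _).le)
      _ = _ := by ring
  have h1 : ‖Complex.exp (-(α * (‖z‖ : ℂ) ^ 2 / 2))‖ = Real.exp (-(m / 2)) := by
    rw [Complex.norm_exp]
    congr 1
    rw [hm]
    norm_cast
  have h2 : ‖((‖kernelVec α z‖ : ℂ))⁻¹‖ = Real.exp (-(m / 2)) := by
    rw [norm_inv, Complex.norm_real, norm_norm, norm_kernelVec, Real.exp_neg]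
  rw [berezin_hToeplitz, normKernelVec, map_smul, map_smul, inner_smul_right, norm_mul, norm_mul,
    h1, h2]
  calc _ ≤ Real.exp (-(m / 2)) * (Real.exp (-(m / 2)) *
        (M * (Real.exp (50 / 119 * m)) * (2 * Real.exp (4 / 7 * m)) * (1 - ρ)⁻¹)) := by gcongr
    _ = M * 2 * (1 - ρ)⁻¹ * (Real.exp (-(m / 2)) * Real.exp (-(m / 2)) *
        Real.exp (50 / 119 * m) * Real.exp (4 / 7 * m)) := by ring
    _ = _ := by
      -- The exponents add up to a negative multiple of `m`: `-1/2 - 1/2 + 50/119 + 68/119 =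
      -- -1/119`.
      rw [← Real.exp_add, ← Real.exp_add, ← Real.exp_add]
      ring_nf

theorem tendsto_berezin_hToeplitz (φ : ℂ → ℂ) (hφ : MemLp φ ∞ volume) :
    Tendsto (berezin α (hToeplitz α φ hφ)) (cocompact ℂ) (𝓝 0) := by
  obtain ⟨C, hC⟩ := norm_berezin_hToeplitz_le α φ hφ
  refine squeeze_zero_norm hC ?_
  rw [← mul_zero C]
  refine Tendsto.const_mul C (Real.tendsto_exp_atBot.comp ?_)
  refine Tendsto.const_mul_atTop_of_neg (by norm_num) ?_
  exact ((tendsto_pow_atTop two_ne_zero).comp tendsto_norm_cocompact_atTop).const_mul_atTop hα.out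

end

end HToeplitz

theorem mainTheorem5 (α : ℝ) [Fact (0 < α)] (φ : ℂ → ℂ) (hφ : MemLp φ ∞ (volume : Measure ℂ)) :
    (∀ z : ℂ,
      Integrable
        (fun w : ℂ => φ w * HToeplitz.dilatedKernel α z w * Complex.exp (α * z * conj w))
        (HToeplitz.gaussianMeasure α) ∧
      HToeplitz.berezin α (HToeplitz.hToeplitz α φ hφ) z =
        Complex.exp (-(α * (‖z‖ : ℂ) ^ 2 / 2)) *
          ∫ w : ℂ, φ w * HToeplitz.dilatedKernel α z w * Complex.exp (α * z * conj w)
            ∂HToeplitz.gaussianMeasure α) ∧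
    Tendsto (HToeplitz.berezin α (HToeplitz.hToeplitz α φ hφ)) (cocompact ℂ) (𝓝 0) := by
  exact ⟨fun z => ⟨HToeplitz.integrable_mul_conj_kernelFun α φ hφ _ z, by
      rw [HToeplitz.berezin_hToeplitz, HToeplitz.inner_kernelVec_mulOp]
      rfl⟩, HToeplitz.tendsto_berezin_hToeplitz α φ hφ⟩
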